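/- Conventions. A set is countable if it is finite or countably infinite. $\mathfrak c$ is the cardinality of the continuum and $\mathfrak c^+$ its successor cardinal. Every ordinal $\lambda$ is uniquely of the form $\lambda=\lim\lambda+n$ with $\lim\lambda$ a limit ordinal ($0$ counts as limit) and $n<\omega$; $\mathsf{cf}$ denotes cofinality, with $\mathsf{cf}(\alpha)=1$ for successor $\alpha$. A set $L\subseteq\omega^\omega$ is $\mathcal K$-Lusin if $K\cap L$ is countable for every compact $K\subseteq\omega^\omega$, where $\omega^\omega$ has the product topology of discrete spaces. A space is scattered if each of its nonempty subspaces has an isolated point. For a space $X$ put $X^{(0)}=X$ and, for $\alpha>0$, $X^{(\alpha)}=\bigcap_{\xi<\alpha}(X^{(\xi)})^{(1)}$, where $A^{(1)}$ is the set of non-isolated points of the subspace $A$. For scattered $X$ the height of $x\in X$ is the unique ordinal $\alpha$ with $x\in X^{(\alpha)}\setminus X^{(\alpha+1)}$; the set of all heights of points of $X$ is an ordinal, called the scattered height of $X$. An FLS space is a first-countable Lindelöf scattered Hausdorff space. A height function on a nonempty space $Y$ is a surjection $h$ from $Y$ onto an ordinal such that for every $\alpha$ in this ordinal $h^{-1}\{\alpha\}$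 is dense in $\{y\in Y:h(y)\ge\alpha\}$. The scattered $h$-modification of $Y$ is the set $Y$ with the topology generated by the base of all sets $\{x\}\cup\{y\in U:h(y)<h(x)\}$, where $U$ is open in $Y$ and $x\in U$. A scattered space is special if it is homeomorphic to a scattered $h$-modification of some metrizable space for some height function $h$. Theorem 4.3. If there exists a $\mathcal K$-Lusin set of uncountable cardinality $\kappa$, then for every infinite ordinal $\lambda<\mathfrak c^+$ with $\mathsf{cf}(\lambda)\le\omega$ and $\mathsf{cf}(\lim\lambda)\le\kappa$ there exists a separable special FLS space of cardinality $\mathfrak c$ and scattered height $\lambda$. -/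

import Mathlib

open Set Topology Cardinal Ordinal

universe u

/-- A subset `L` of a topological space is `𝒦`-Lusin if it meets every compact set in a
countable set. -/
def IsKLusin {X : Type u} [TopologicalSpace X] (L : Set X) : Prop :=
  ∀ K : Set X, IsCompact K → (K ∩ L).Countable

/-- The limit part of an ordinal `o`: the limit ordinal `l` (where `0` counts as limit) with
`o = l + n` for some finite `n`; see `limitPart_eq_iff`. -/
noncomputable def limitPart (o : Ordinal.{u}) : Ordinal.{u} := ω * (o / ω)

theorem limitPart_eq_iff (o l : Ordinal.{u}) :
    limitPart o = l ↔ Order.IsSuccPrelimit l ∧ ∃ n : ℕ, o = l + n := by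
  constructor
  · rintro rfl
    refine ⟨Ordinal.isSuccPrelimit_iff_omega0_dvd.2 ⟨_, rfl⟩, ?_⟩
    obtain ⟨n, hn⟩ := Ordinal.lt_omega0.1 (Ordinal.mod_lt o Ordinal.omega0_ne_zero)
    exact ⟨n, by rw [← hn]; exact (Ordinal.div_add_mod o ω).symm⟩
  · rintro ⟨hl, n, rfl⟩
    obtain ⟨c, rfl⟩ := Ordinal.isSuccPrelimit_iff_omega0_dvd.1 hl
    rw [limitPart, Ordinal.mul_add_div _ Ordinal.omega0_ne_zero,
      Ordinal.div_eq_zero_of_lt (Ordinal.natCast_lt_omega0 n), add_zero]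

section Scattered

variable (X : Type u) [TopologicalSpace X]

/-- A space is scattered if every nonempty subspace has an isolated point. -/
def IsScattered : Prop :=
  ∀ S : Set X, S.Nonempty → ∃ x ∈ S, ∃ U : Set X, IsOpen U ∧ U ∩ S = {x}

variable {X} in
/-- The Cantor-Bendixson derivative of a subspace `A`: the non-isolated points of `A`. -/
def nonIsolatedPoints (A : Set X) : Set X :=
  {x | x ∈ A ∧ ¬ ∃ U : Set X, IsOpen U ∧ U ∩ A = {x}}

/-- The iterated Cantor-Bendixson derivatives `X^(α)` of `X`: the intersection over `ξ < α` of
the derivatives of `X^(ξ)`. For `α = 0` the intersection is empty, so that `X^(0) = X`. -/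
def cbDerivative (α : Ordinal.{u}) : Set X :=
  ⋂ ξ : Set.Iio α, nonIsolatedPoints (cbDerivative ξ.1)
termination_by α
decreasing_by exact ξ.2

/-- `X^(∞)`, the intersection of all the iterated derivatives. -/
def cbKernel : Set X := ⋂ α : Ordinal.{u}, cbDerivative X α

open Classical in
/-- The Cantor-Bendixson height of a point: for `x ∉ X^(∞)` it is the unique `α` such that
`x ∈ X^(α) \ X^(α+1)`, and for `x ∈ X^(∞)` the smallest `α` such that `X^(α) = X^(∞)`. -/
noncomputable def cbHeight (x : X) : Ordinal.{u} :=
  if x ∈ cbKernel X then sInf {α | cbDerivative X α = cbKernel X}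
  else sInf {α | x ∈ cbDerivative X α \ cbDerivative X (α + 1)}

/-- The Cantor-Bendixson height (the scattered height, if `X` is scattered) of the space `X` is
the ordinal `l`: the range of the height function is `l = {α | α < l}`. -/
def HasScatteredHeight (l : Ordinal.{u}) : Prop :=
  Set.range (cbHeight X) = Set.Iio l

/-- An FLS space: a Hausdorff space that is first-countable, Lindelöf and scattered. -/
structure IsFLS : Prop where
  t2 : T2Space X
  firstCountable : FirstCountableTopology X
  lindelof : LindelofSpace X
  scattered : IsScattered X

end Scattered

/-- A height function on a nonempty space: a function onto an ordinal `o = {α | α < o}` such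
that for every `α < o` the fibre over `α` is dense in the preimage of `{β | α ≤ β}`. -/
def IsHeightFunction {Y : Type u} [TopologicalSpace Y] (h : Y → Ordinal.{u}) : Prop :=
  Nonempty Y ∧ ∃ o : Ordinal.{u}, Set.range h = Set.Iio o ∧
    ∀ α < o, h ⁻¹' Set.Ici α ⊆ closure (h ⁻¹' {α})

/-- The underlying set of the scattered `h`-modification of `Y`. -/
def ScatteredModification {Y : Type u} (_h : Y → Ordinal.{u}) : Type u := Y

/-- The topology of the scattered `h`-modification, generated by the sets
`{x} ∪ {y ∈ U | h y < h x}` for `U` open in `Y` and `x ∈ U`. -/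
instance ScatteredModification.instTopologicalSpace {Y : Type u} [TopologicalSpace Y]
    (h : Y → Ordinal.{u}) : TopologicalSpace (ScatteredModification h) :=
  TopologicalSpace.generateFrom
    {B : Set Y | ∃ (x : Y) (U : Set Y), IsOpen U ∧ x ∈ U ∧ B = {x} ∪ {y | y ∈ U ∧ h y < h x}}

/-- A scattered space is special if it is homeomorphic to a scattered modification of some
metrizable space. -/
def IsSpecial (X : Type u) [TopologicalSpace X] : Prop :=
  IsScattered X ∧ ∃ (Y : Type u) (_ : TopologicalSpace Y) (h : Y → Ordinal.{u}),
    TopologicalSpace.MetrizableSpace Y ∧ IsHeightFunction h ∧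
      Nonempty (X ≃ₜ ScatteredModification h)

/-!
Each required space is the modification of a separable metrizable space `Y` by a height function
`h` onto the given ordinal. Assume that the level of height `0` is countable. The modification is
then Hausdorff, first-countable, scattered and separable, and its Cantor-Bendixson height is `h`
(`ScatteredModification.cbHeight_eq`). The point is to make it Lindelöf.

The tool is a Bernstein decomposition: up to `𝔠` many disjoint sets, each of which meets every
uncountable closed set (`exists_bernstein_levels`). If a closed set `F` is decomposed into such
levels, then an open set that contains one level of `F` leaves out only countably many points of
`F`. Apply this to levels whose heights form a sequence with limit `m`: the points of `F` of
height below `m` form a Lindelöf subspace of the modification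
(`exists_countable_cover_of_isClosed`). With `F = ℝ` this settles all limit heights of countable
cofinality (`exists_isLindelofTower_of_cof_le`). A further level can always be added on top of a
tower, as a point to which countably many copies of the tower converge
(`IsLindelofTower.exists_add_one`).

There remain the heights `μ + 1` with `μ` a limit of uncountable cofinality at most `κ`. Here the
`𝒦`-Lusin set `L` is used. The monotone sequences of natural numbers have a compactification with
countable remainder `D`, namely the space of monotone sequences in `ℕ∞`. For `l ∈ L` let `F l` be
the Cantor set of the partial sums of all sequences `l + e` with `e` a `0`-`1` sequence. A compact
set disjoint from `D` is bounded by a sequence, and since `L` is `𝒦`-Lusin it meets `F l` for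
countably many `l` only: the sets `F l` are concentrated on `D`. Put the points of `F l` of
Bernstein height below `mₗ` into `Y`, where the ordinals `mₗ ≤ μ` have cofinality `ω` and are
unbounded in `μ`, and put on top of them, at height `μ`, the points of `D` at which the sets `F l`
with large `mₗ` accumulate. Neighbourhoods of these countably many points cover all but countably
many of the pieces, and each piece is Lindelöf (`exists_isLindelofTower_of_concentrated`).
-/

/-! ### The topology of a scattered modification -/

namespace ScatteredModification

/-- The identity map of a scattered modification onto the space that it modifies. -/
def toBase {Y : Type u} (h : Y → Ordinal.{u}) : ScatteredModification h ≃ Y := Equiv.refl Y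

/-- The basic neighbourhood of `x` in the scattered `h`-modification that `U` determines. -/
def basicNhd {Y : Type u} {h : Y → Ordinal.{u}} (x : ScatteredModification h) (U : Set Y) :
    Set (ScatteredModification h) :=
  {x} ∪ {y | toBase h y ∈ U ∧ h (toBase h y) < h (toBase h x)}

section

variable {Y : Type u} {h : Y → Ordinal.{u}} {x z : ScatteredModification h} {U V : Set Y}

theorem basicNhd_subset (hz : z ∈ basicNhd x U) : basicNhd z U ⊆ basicNhd x U := by
  rcases hz with rfl | ⟨hzU, hzx⟩
  · exact subset_rfl
  · rintro y (rfl | ⟨hyU, hyz⟩)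
    · exact Or.inr ⟨hzU, hzx⟩
    · exact Or.inr ⟨hyU, hyz.trans hzx⟩

theorem basicNhd_mono (hUV : U ⊆ V) : basicNhd x U ⊆ basicNhd x V :=
  union_subset_union_right _ fun _ hy ↦ ⟨hUV hy.1, hy.2⟩

theorem toBase_mem_of_mem_basicNhd (hx : toBase h x ∈ U) (hz : z ∈ basicNhd x U) :
    toBase h z ∈ U := by
  rcases hz with rfl | hz
  exacts [hx, hz.1]

end

variable {Y : Type u} [TopologicalSpace Y] {h : Y → Ordinal.{u}}

theorem isOpen_basicNhd {x : ScatteredModification h} {U : Set Y} (hU : IsOpen U)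
    (hx : toBase h x ∈ U) : IsOpen (basicNhd x U) :=
  TopologicalSpace.isOpen_generateFrom_of_mem ⟨toBase h x, U, hU, hx, rfl⟩

/-- A set is open in the modification iff it contains a basic neighbourhood of each of its
points. -/
theorem isOpen_iff {O : Set (ScatteredModification h)} : IsOpen O ↔
    ∀ z ∈ O, ∃ U : Set Y, IsOpen U ∧ toBase h z ∈ U ∧ basicNhd z U ⊆ O := by
  constructor
  · intro hO
    induction hO with
    | basic s hs =>
      obtain ⟨x, U, hU, hx, rfl⟩ := hs
      intro z hz
      obtain ⟨x, rfl⟩ := (toBase h).surjective x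
      exact ⟨U, hU, toBase_mem_of_mem_basicNhd hx hz, basicNhd_subset hz⟩
    | univ => exact fun z _ ↦ ⟨univ, isOpen_univ, mem_univ _, subset_univ _⟩
    | inter s t _ _ hs ht =>
      intro z hz
      obtain ⟨U, hU, hzU, hUs⟩ := hs z hz.1
      obtain ⟨V, hV, hzV, hVt⟩ := ht z hz.2
      exact ⟨U ∩ V, hU.inter hV, ⟨hzU, hzV⟩, subset_inter
        ((basicNhd_mono inter_subset_left).trans hUs)
        ((basicNhd_mono inter_subset_right).trans hVt)⟩
    | sUnion S _ hS =>
      rintro z ⟨s, hs, hzs⟩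
      obtain ⟨U, hU, hzU, hUs⟩ := hS s hs z hzs
      exact ⟨U, hU, hzU, hUs.trans (subset_sUnion_of_mem hs)⟩
  · intro H
    choose! U hU hzU hUO using H
    have : O = ⋃ z ∈ O, basicNhd z (U z) := by
      apply subset_antisymm
      · exact fun z hz ↦ mem_biUnion hz (Or.inl rfl)
      · exact iUnion₂_subset hUO
    rw [this]
    exact isOpen_biUnion fun z hz ↦ isOpen_basicNhd (hU z hz) (hzU z hz)

theorem continuous_toBase : Continuous (toBase h) :=
  ⟨fun U hU ↦ isOpen_iff.2 fun _ hz ↦ ⟨U, hU, hz, fun _ ↦ toBase_mem_of_mem_basicNhd hz⟩⟩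

theorem t2Space [T2Space Y] : T2Space (ScatteredModification h) :=
  T2Space.of_injective_continuous (toBase h).injective continuous_toBase

theorem nhds_eq (x : ScatteredModification h) : 𝓝 x = pure x ⊔
    (Filter.comap (toBase h) (𝓝 (toBase h x)) ⊓
      Filter.principal {y | h (toBase h y) < h (toBase h x)}) := by
  ext N
  rw [mem_nhds_iff, Filter.mem_sup, Filter.mem_pure, Filter.mem_inf_principal,
    Filter.mem_comap]
  constructor
  · rintro ⟨O, hON, hO, hxO⟩
    obtain ⟨U, hU, hxU, hUO⟩ := isOpen_iff.1 hO x hxO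
    exact ⟨hON hxO, U, hU.mem_nhds hxU, fun y hy hyx ↦ hON (hUO (Or.inr ⟨hy, hyx⟩))⟩
  · rintro ⟨hxN, V, hV, hVN⟩
    obtain ⟨U, hUV, hU, hxU⟩ := mem_nhds_iff.1 hV
    refine ⟨basicNhd x U, ?_, isOpen_basicNhd hU hxU, Or.inl rfl⟩
    rintro y (rfl | hy)
    exacts [hxN, hVN (hUV hy.1) hy.2]

theorem firstCountableTopology [FirstCountableTopology Y] :
    FirstCountableTopology (ScatteredModification h) := by
  refine ⟨fun x ↦ ?_⟩
  rw [nhds_eq]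
  infer_instance

theorem isScattered : IsScattered (ScatteredModification h) := by
  intro S hS
  obtain ⟨x, hxS, hmin⟩ :=
    exists_minimalFor_of_wellFoundedLT (· ∈ S) (fun y ↦ h (toBase h y)) hS
  refine ⟨x, hxS, basicNhd x univ, isOpen_basicNhd isOpen_univ (mem_univ _), ?_⟩
  apply subset_antisymm
  · rintro y ⟨rfl | ⟨-, hyx⟩, hyS⟩
    · rfl
    · exact absurd (hmin hyS hyx.le) hyx.not_ge
  · rintro _ rfl
    exact ⟨Or.inl rfl, hxS⟩

/-- If every fibre of `h` over `α` accumulates at all points of height at least `α`, then the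
derivatives of the modification are the superlevel sets of `h`. -/
theorem cbDerivative_eq (hd : ∀ y, ∀ α ≤ h y, y ∈ closure (h ⁻¹' {α})) (α : Ordinal.{u}) :
    cbDerivative (ScatteredModification h) α = {x | α ≤ h (toBase h x)} := by
  induction α using WellFoundedLT.induction with
  | ind α ih =>
  have key : ∀ ξ : Iio α, nonIsolatedPoints (cbDerivative (ScatteredModification h) ξ.1) =
      {x | ξ.1 < h (toBase h x)} := by
    rintro ⟨ξ, hξ⟩
    rw [ih ξ hξ]
    ext x
    constructor
    · rintro ⟨hx, hiso⟩
      have hx' : ξ ≤ h (toBase h x) := hx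
      refine lt_of_le_of_ne hx' fun heq ↦ hiso ?_
      refine ⟨basicNhd x univ, isOpen_basicNhd isOpen_univ (mem_univ _), ?_⟩
      apply subset_antisymm
      · rintro y ⟨rfl | ⟨-, hyx⟩, hy⟩
        · rfl
        · exact absurd (hyx.trans_eq heq.symm) (not_lt.2 hy)
      · rintro _ rfl
        exact ⟨Or.inl rfl, hx⟩
    · intro hx
      have hx' : ξ < h (toBase h x) := hx
      refine ⟨hx'.le, ?_⟩
      rintro ⟨O, hO, hOx⟩
      have hxO : x ∈ O := (hOx.symm.subset rfl).1
      obtain ⟨U, hU, hxU, hUO⟩ := isOpen_iff.1 hO x hxO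
      obtain ⟨y, hyU, hy⟩ := mem_closure_iff.1 (hd _ ξ hx'.le) U hU hxU
      obtain ⟨y, rfl⟩ := (toBase h).surjective y
      have hyξ : h (toBase h y) = ξ := hy
      have hyx : y = x := hOx.subset ⟨hUO (Or.inr ⟨hyU, hyξ.trans_lt hx'⟩), hyξ.ge⟩
      exact hx'.ne (hyx ▸ hyξ).symm
  rw [cbDerivative, iInter_congr key]
  ext x
  simp only [mem_iInter, Subtype.forall, mem_Iio, mem_ofPred_eq]
  exact ⟨fun H ↦ le_of_forall_lt H, fun H ξ hξ ↦ lt_of_lt_of_le hξ H⟩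

theorem cbHeight_eq (hd : ∀ y, ∀ α ≤ h y, y ∈ closure (h ⁻¹' {α}))
    (x : ScatteredModification h) : cbHeight (ScatteredModification h) x = h (toBase h x) := by
  have hx : x ∉ cbKernel (ScatteredModification h) := by
    intro hx
    have := mem_iInter.1 hx (h (toBase h x) + 1)
    rw [cbDerivative_eq hd] at this
    exact (lt_add_one (h (toBase h x))).not_ge this
  have hset : {α | x ∈ cbDerivative (ScatteredModification h) α \
      cbDerivative (ScatteredModification h) (α + 1)} = {h (toBase h x)} := by
    ext α
    simp only [mem_ofPred_eq, mem_singleton_iff, mem_sdiff, cbDerivative_eq hd, not_le,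
      Order.lt_add_one_iff]
    exact le_antisymm_iff.symm
  rw [cbHeight, if_neg hx, hset, csInf_singleton]

end ScatteredModification

/-! ### Lindelöf towers -/

/-- A function `h` on a space `Y` of cardinality `𝔠` that has all properties of a height function
onto `o` which are needed for its scattered modification to be a separable Lindelöf space of
height `o`, together with a point at which every level accumulates. Such a point allows to add one
more level. -/
structure IsLindelofTower {Y : Type} [TopologicalSpace Y] (h : Y → Ordinal.{0})
    (o : Ordinal.{0}) : Prop where
  lt : ∀ y, h y < o
  mem_closure : ∀ y, ∀ α ≤ h y, y ∈ closure (h ⁻¹' {α})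
  exists_center : ∃ c, ∀ α < o, c ∈ closure (h ⁻¹' {α})
  countable_zero : (h ⁻¹' {0}).Countable
  /-- The Lindelöf property of the scattered modification, in terms of basic neighbourhoods. -/
  exists_countable_cover : ∀ U : Y → Set Y, (∀ y, IsOpen (U y)) → (∀ y, y ∈ U y) →
    ∃ S : Set Y, S.Countable ∧ ∀ y, y ∈ S ∨ ∃ s ∈ S, y ∈ U s ∧ h y < h s
  card_eq : #Y = 𝔠

namespace IsLindelofTower

variable {Y : Type} [TopologicalSpace Y] {h : Y → Ordinal.{0}} {o : Ordinal.{0}}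

theorem range_eq (H : IsLindelofTower h o) : range h = Iio o := by
  apply subset_antisymm
  · rintro _ ⟨y, rfl⟩
    exact H.lt y
  · intro α hα
    obtain ⟨c, hc⟩ := H.exists_center
    obtain ⟨y, hy⟩ := closure_nonempty_iff.1 ⟨c, hc α hα⟩
    exact ⟨y, hy⟩

open ScatteredModification

theorem lindelofSpace (H : IsLindelofTower h o) : LindelofSpace (ScatteredModification h) := by
  refine ⟨isLindelof_of_countable_subcover fun {ι} O hO hcov ↦ ?_⟩
  have hex : ∀ y : Y, ∃ i, ∃ U : Set Y, IsOpen U ∧ y ∈ U ∧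
      basicNhd ((toBase h).symm y) U ⊆ O i := by
    intro y
    obtain ⟨i, hi⟩ := mem_iUnion.1 (hcov (mem_univ ((toBase h).symm y)))
    exact ⟨i, isOpen_iff.1 (hO i) _ hi⟩
  choose i U hU hyU hUO using hex
  obtain ⟨S, hS, hcovS⟩ := H.exists_countable_cover U hU hyU
  refine ⟨i '' S, hS.image i, fun y _ ↦ ?_⟩
  rcases hcovS (toBase h y) with hy | ⟨s, hs, hy⟩
  · exact mem_biUnion (mem_image_of_mem i hy) (hUO _ (Or.inl rfl))
  · exact mem_biUnion (mem_image_of_mem i hs) (hUO s (Or.inr hy))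

theorem separableSpace (H : IsLindelofTower h o) :
    TopologicalSpace.SeparableSpace (ScatteredModification h) := by
  refine ⟨toBase h ⁻¹' (h ⁻¹' {0}), H.countable_zero.preimage (toBase h).injective, ?_⟩
  rw [dense_iff_inter_open]
  rintro O hO ⟨z, hz⟩
  obtain ⟨U, hU, hzU, hUO⟩ := isOpen_iff.1 hO z hz
  rcases eq_or_ne (h (toBase h z)) 0 with h0 | h0
  · exact ⟨z, hz, h0⟩
  · obtain ⟨y, hyU, hy⟩ := mem_closure_iff.1 (H.mem_closure _ 0 zero_le) U hU hzU
    obtain ⟨y, rfl⟩ := (toBase h).surjective y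
    have hy0 : h (toBase h y) = 0 := hy
    exact ⟨y, hUO (Or.inr ⟨hyU, by rw [hy0]; exact pos_iff_ne_zero.2 h0⟩), hy⟩

theorem isHeightFunction (H : IsLindelofTower h o) : IsHeightFunction h :=
  ⟨H.exists_center.nonempty, o, H.range_eq, fun α _ y hy ↦ H.mem_closure y α hy⟩

theorem exists_space [TopologicalSpace.MetrizableSpace Y] (H : IsLindelofTower h o) :
    ∃ (X : Type) (_ : TopologicalSpace X),
      IsFLS X ∧ IsSpecial X ∧ TopologicalSpace.SeparableSpace X ∧ #X = 𝔠 ∧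
        HasScatteredHeight X o := by
  refine ⟨ScatteredModification h, inferInstance,
    ⟨t2Space, firstCountableTopology, H.lindelofSpace, isScattered⟩, ⟨isScattered, ?_⟩,
    H.separableSpace, H.card_eq, ?_⟩
  · exact ⟨Y, inferInstance, h, inferInstance, H.isHeightFunction, ⟨Homeomorph.refl _⟩⟩
  · rw [HasScatteredHeight, funext (cbHeight_eq H.mem_closure), ← H.range_eq]
    exact (toBase h).surjective.range_comp h

end IsLindelofTower

/-! ### Bernstein decompositions -/

/-- A family of at most `𝔠` sets of size at least `𝔠` has an injective choice function. -/
theorem exists_injective_mem {ι : Type} {X : Type} (hι : #ι ≤ 𝔠) (A : ι → Set X)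
    (hA : ∀ i, 𝔠 ≤ #(A i)) : ∃ f : ι → X, Function.Injective f ∧ ∀ i, f i ∈ A i := by
  obtain ⟨_, _, hord⟩ := Cardinal.exists_ord_eq_type_lt ι
  have hstep : ∀ (i : ι) (F : ∀ j, j < i → X), ∃ y ∈ A i, ∀ j hj, F j hj ≠ y := by
    intro i F
    by_contra! hcon
    have hsub : A i ⊆ range fun j : Iio i ↦ F j.1 j.2 := by
      intro y hy
      obtain ⟨j, hj, hjy⟩ := hcon y hy
      exact ⟨⟨j, hj⟩, hjy⟩
    have h1 : #(A i) ≤ #(Iio i) := (mk_le_mk_of_subset hsub).trans mk_range_le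
    exact ((hA i).trans h1).not_gt ((mk_Iio_lt i hord).trans_le hι)
  choose y hyA hyF using hstep
  let f : ι → X := (wellFounded_lt (α := ι)).fix y
  have hf : ∀ i, f i = y i fun j _ ↦ f j := fun i ↦ WellFounded.fix_eq _ _ _
  have hne : ∀ i j, j < i → f j ≠ f i := by
    intro i j hj
    rw [hf i]
    exact hyF i (fun j _ ↦ f j) j hj
  refine ⟨f, fun i j hij ↦ ?_, fun i ↦ hf i ▸ hyA i _⟩
  rcases lt_trichotomy i j with h | h | h
  · exact absurd hij (hne j i h)
  · exact h
  · exact absurd hij.symm (hne i j h)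

theorem mk_isClosed_le (E : Type) [TopologicalSpace E] [SecondCountableTopology E] :
    #{K : Set E // IsClosed K} ≤ 𝔠 := by
  let B := TopologicalSpace.countableBasis E
  have hB := TopologicalSpace.isBasis_countableBasis E
  have hinj : Function.Injective
      (fun K : {K : Set E // IsClosed K} ↦ ({b | b.1 ⊆ K.1ᶜ} : Set B)) := by
    intro K K' h
    apply Subtype.ext
    rw [← compl_inj_iff]
    rw [hB.open_eq_sUnion' K.2.isOpen_compl, hB.open_eq_sUnion' K'.2.isOpen_compl]
    congr 1
    ext b
    exact and_congr_right fun hb ↦ Set.ext_iff.1 h ⟨b, hb⟩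
  calc #{K : Set E // IsClosed K} ≤ #(Set B) := mk_le_of_injective hinj
    _ = 2 ^ #B := mk_set
    _ ≤ 2 ^ ℵ₀ := by
      exact power_le_power_left two_ne_zero
        (TopologicalSpace.countable_countableBasis E).le_aleph0
    _ = 𝔠 := two_power_aleph0

theorem mk_le_continuum_of_secondCountable (E : Type) [TopologicalSpace E]
    [SecondCountableTopology E] [T1Space E] : #E ≤ 𝔠 :=
  (mk_le_of_injective (f := fun x : E ↦ (⟨{x}, isClosed_singleton⟩ : {K : Set E // IsClosed K}))
    fun _ _ h ↦ singleton_injective (congrArg Subtype.val h)).trans (mk_isClosed_le E)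

theorem continuum_le_mk_of_isClosed {E : Type} [TopologicalSpace E] [PolishSpace E] {K : Set E}
    (hK : IsClosed K) (hunc : ¬ K.Countable) : 𝔠 ≤ #K := by
  obtain ⟨f, hf, -, hinj⟩ := hK.exists_nat_bool_injection_of_not_countable hunc
  have : #(ℕ → Bool) = 𝔠 := by simp
  rw [← this]
  exact mk_le_of_injective (f := fun x ↦ (⟨f x, hf ⟨x, rfl⟩⟩ : K))
    fun _ _ h ↦ hinj (congrArg Subtype.val h)


/-- A Bernstein decomposition of a Polish space into the countable set `Q` as level `0` and further
levels, as many as there are non-zero ordinals below `μ`, each of which meets all uncountable closed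
sets in `𝔠` points. -/
theorem exists_bernstein_levels {E : Type} [TopologicalSpace E] [PolishSpace E] {Q : Set E}
    (hQ : Q.Countable) {μ : Ordinal.{0}} (hμ : 1 < μ) (hμc : μ.card ≤ 𝔠) :
    ∃ g : E → Ordinal.{0}, (∀ x, g x = 0 ↔ x ∈ Q) ∧ (∀ x, g x < μ) ∧
      ∀ K : Set E, IsClosed K → ¬ K.Countable → ∀ α, α ≠ 0 → α < μ →
        𝔠 ≤ #(K ∩ g ⁻¹' {α} : Set E) := by
  classical
  let ι := {K : Set E // IsClosed K ∧ ¬ K.Countable} × μ.ToType × (ℕ → Bool)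
  have hbool : #(ℕ → Bool) = 𝔠 := by simp
  have hι : #ι ≤ 𝔠 := by
    have h1 : #{K : Set E // IsClosed K ∧ ¬ K.Countable} ≤ 𝔠 :=
      (mk_subtype_mono fun _ h ↦ h.1).trans (mk_isClosed_le E)
    have h2 : #μ.ToType ≤ 𝔠 := by rwa [mk_toType]
    simp only [ι, mk_prod, Cardinal.lift_id, hbool]
    calc _ ≤ 𝔠 * (𝔠 * 𝔠) := by gcongr
      _ = 𝔠 := by simp
  obtain ⟨f, hf, hfA⟩ := exists_injective_mem hι (fun i ↦ i.1.1 \ Q) (by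
    intro i
    by_contra! hlt
    -- If `K \ Q` had fewer than `𝔠` points, then so would `K`, because `Q` is countable.
    have h1 := continuum_le_mk_of_isClosed i.1.2.1 i.1.2.2
    have h2 := h1.trans (le_mk_sdiff_add_mk i.1.1 Q)
    exact h2.not_gt (add_lt_of_lt aleph0_le_continuum hlt
      (hQ.le_aleph0.trans_lt aleph0_lt_continuum)))
  let v : μ.ToType → Ordinal.{0} := fun a ↦ (Ordinal.ToType.mk.symm a).1
  have hv : ∀ a, v a < μ := fun a ↦ (Ordinal.ToType.mk.symm a).2
  -- Points outside all the chosen sets are put into level `1`.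
  let g : E → Ordinal.{0} := fun x ↦ if x ∈ Q then 0 else
    if hx : ∃ i, f i = x then max 1 (v hx.choose.2.1) else 1
  refine ⟨g, ?_, ?_, ?_⟩
  · intro x
    by_cases hx : x ∈ Q
    · simp [g, hx]
    · simp only [g, hx, if_false, iff_false]
      split_ifs with h
      · exact (zero_lt_one.trans_le (le_max_left _ _)).ne'
      · exact one_ne_zero
  · intro x
    simp only [g]
    split_ifs with h1 h2
    · exact zero_lt_one.trans hμ
    · exact max_lt hμ (hv _)
    · exact hμ
  · intro K hK hKc α hα0 hαμ
    let a : μ.ToType := Ordinal.ToType.mk ⟨α, hαμ⟩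
    have ha : v a = α := by simp [v, a]
    let F : (ℕ → Bool) → E := fun e ↦ f (⟨K, hK, hKc⟩, a, e)
    have hF : ∀ e, F e ∈ (K ∩ g ⁻¹' {α} : Set E) := by
      intro e
      have hmem := hfA (⟨K, hK, hKc⟩, a, e)
      refine ⟨hmem.1, ?_⟩
      have hex : ∃ i, f i = F e := ⟨_, rfl⟩
      have hch : hex.choose = (⟨K, hK, hKc⟩, a, e) := hf hex.choose_spec
      have hnQ : F e ∉ Q := hmem.2
      simp only [mem_preimage, mem_singleton_iff, g, hnQ, if_false]
      rw [dif_pos hex, hch, ha]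
      exact max_eq_right (Order.one_le_iff_pos.2 (pos_iff_ne_zero.2 hα0))
    rw [← hbool]
    refine mk_le_of_injective (f := fun e ↦ (⟨F e, hF e⟩ : (K ∩ g ⁻¹' {α} : Set E))) ?_
    intro e e' h
    have := hf (congrArg Subtype.val h)
    exact congrArg (fun i : ι ↦ i.2.2) this

/-! ### Pieces cut out of locally uncountable closed sets -/

section

variable {E : Type} [TopologicalSpace E] [PolishSpace E] {g : E → Ordinal.{0}} {μ : Ordinal.{0}}

theorem continuum_le_mk_inter_level
    (hg : ∀ K : Set E, IsClosed K → ¬ K.Countable → ∀ α, α ≠ 0 → α < μ →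
      𝔠 ≤ #(K ∩ g ⁻¹' {α} : Set E))
    {F : Set E} (hF : IsClosed F) (hFu : ∀ U, IsOpen U → (F ∩ U).Nonempty → ¬ (F ∩ U).Countable)
    {U : Set E} (hU : IsOpen U) (hne : (F ∩ U).Nonempty) {α : Ordinal.{0}} (hα : α ≠ 0)
    (hαμ : α < μ) : 𝔠 ≤ #(F ∩ U ∩ g ⁻¹' {α} : Set E) := by
  obtain ⟨x, hxF, hxU⟩ := hne
  obtain ⟨N, hN, hNc, hNU⟩ := exists_mem_nhds_isClosed_subset (hU.mem_nhds hxU)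
  have hunc : ¬ (F ∩ N).Countable := fun hc ↦ hFu (interior N) isOpen_interior
    ⟨x, hxF, mem_interior_iff_mem_nhds.2 hN⟩
    (hc.mono (inter_subset_inter_right _ interior_subset))
  refine (hg _ (hF.inter hNc) hunc α hα hαμ).trans (mk_le_mk_of_subset ?_)
  exact inter_subset_inter_left _ (inter_subset_inter_right _ hNU)

/-- The points of height below `m` of a closed set form a Lindelöf subspace of the modification
if `m` is the limit of a sequence of Bernstein levels: the neighbourhoods of the points of one level
of the sequence cover all lower points of the closed set, with countably many exceptions. -/
theorem exists_countable_cover_of_isClosed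
    (hg : ∀ K : Set E, IsClosed K → ¬ K.Countable → ∀ α, α ≠ 0 → α < μ →
      𝔠 ≤ #(K ∩ g ⁻¹' {α} : Set E))
    {F : Set E} (hF : IsClosed F) {m : Ordinal.{0}} (hm : m ≤ μ) {a : ℕ → Ordinal.{0}}
    (ha0 : ∀ n, a n ≠ 0) (ham : ∀ n, a n < m) (hacof : ∀ β < m, ∃ n, β < a n)
    {U : E → Set E} (hU : ∀ x, IsOpen (U x)) (hxU : ∀ x, x ∈ U x) :
    ∃ S : Set E, S.Countable ∧ S ⊆ {x | x ∈ F ∧ g x < m} ∧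
      ∀ y ∈ F, g y < m → y ∈ S ∨ ∃ s ∈ S, y ∈ U s ∧ g y < g s := by
  have hT : ∀ n, ∃ T ⊆ F ∩ g ⁻¹' {a n}, T.Countable ∧
      ⋃ x ∈ T, U x = ⋃ x ∈ F ∩ g ⁻¹' {a n}, U x :=
    fun n ↦ TopologicalSpace.isOpen_biUnion_countable _ U fun x _ ↦ hU x
  choose T hTF hTc hTU using hT
  have hR : ∀ n, (F \ ⋃ x ∈ T n, U x).Countable := by
    intro n
    by_contra hunc
    have hcl : IsClosed (F \ ⋃ x ∈ T n, U x) := hF.sdiff (isOpen_biUnion fun x _ ↦ hU x)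
    have hc := hg _ hcl hunc (a n) (ha0 n) ((ham n).trans_le hm)
    have hne : (((F \ ⋃ x ∈ T n, U x) ∩ g ⁻¹' {a n} : Set E)).Nonempty := by
      rw [← nonempty_coe_sort, ← mk_ne_zero_iff]
      exact (continuum_pos.trans_le hc).ne'
    obtain ⟨x, ⟨hxF, hxn⟩, hxa⟩ := hne
    rw [hTU n] at hxn
    exact hxn (mem_biUnion (⟨hxF, hxa⟩ : x ∈ F ∩ g ⁻¹' {a n}) (hxU x))
  refine ⟨⋃ n, (T n ∪ ((F \ ⋃ x ∈ T n, U x) ∩ {x | g x < m})), countable_iUnion fun n ↦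
    (hTc n).union ((hR n).mono inter_subset_left), iUnion_subset fun n ↦ union_subset ?_ ?_, ?_⟩
  · intro x hx
    have hxa : g x = a n := (hTF n hx).2
    exact ⟨(hTF n hx).1, hxa.trans_lt (ham n)⟩
  · exact fun x hx ↦ ⟨hx.1.1, hx.2⟩
  · intro y hyF hym
    obtain ⟨n, hn⟩ := hacof _ hym
    by_cases hy : y ∈ ⋃ x ∈ T n, U x
    · obtain ⟨s, hs, hys⟩ := mem_iUnion₂.1 hy
      have hsa : g s = a n := (hTF n hs).2
      exact Or.inr ⟨s, mem_iUnion.2 ⟨n, Or.inl hs⟩, hys, hsa ▸ hn⟩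
    · exact Or.inl (mem_iUnion.2 ⟨n, Or.inr ⟨⟨hyF, hy⟩, hym⟩⟩)

end

/-! ### Towers of limit height of countable cofinality, and the addition of a level -/

theorem exists_cofinal_map {ι : Type} {μ : Ordinal.{0}} (hμ : Order.IsSuccLimit μ)
    (hι : μ.cof ≤ #ι) :
    ∃ f : ι → Ordinal.{0}, (∀ i, f i < μ) ∧ ∀ β < μ, ∃ i, β < f i := by
  obtain ⟨s, hs, hcard⟩ := Order.exists_cof_eq μ.ToType
  rw [cof_toType] at hcard
  rw [← hcard, le_def] at hι
  obtain ⟨e⟩ := hι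
  have hne : Nonempty s := by
    obtain ⟨x, hx, -⟩ := hs (Ordinal.ToType.mk ⟨0, hμ.bot_lt⟩)
    exact ⟨⟨x, hx⟩⟩
  refine ⟨fun i ↦ (Ordinal.ToType.mk.symm (Function.invFun e i).1).1,
    fun i ↦ (Ordinal.ToType.mk.symm (Function.invFun e i).1).2, fun β hβ ↦ ?_⟩
  obtain ⟨x, hx, hle⟩ := hs (Ordinal.ToType.mk ⟨Order.succ β, hμ.succ_lt hβ⟩)
  refine ⟨e ⟨x, hx⟩, ?_⟩
  simp only [Function.leftInverse_invFun e.injective _]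
  have := Ordinal.ToType.mk.symm.monotone hle
  rw [OrderIso.symm_apply_apply] at this
  exact (Order.lt_succ β).trans_le this

/-- A limit height of countable cofinality is attained by a modification of the real line. -/
theorem exists_isLindelofTower_of_cof_le {μ : Ordinal.{0}} (hμ : Order.IsSuccLimit μ)
    (hcof : μ.cof ≤ ℵ₀) (hμc : μ.card ≤ 𝔠) :
    ∃ h : ℝ → Ordinal.{0}, IsLindelofTower h μ := by
  obtain ⟨f, hfμ, hf⟩ := exists_cofinal_map (ι := ℕ) hμ (by rwa [mk_nat])
  have hμ1 : 1 < μ := by simpa using hμ.succ_lt hμ.bot_lt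
  obtain ⟨g, hg0, hgμ, hg⟩ := exists_bernstein_levels
    (countable_range ((↑) : ℚ → ℝ)) hμ1 hμc
  have hunc : ∀ U : Set ℝ, IsOpen U → (Set.univ ∩ U).Nonempty → ¬ (Set.univ ∩ U).Countable := by
    intro U hU hne hc
    rw [univ_inter] at hne hc
    exact (continuum_le_cardinal_of_isOpen ℝ hU hne).not_gt
      (hc.le_aleph0.trans_lt aleph0_lt_continuum)
  have hdense : ∀ α < μ, ∀ x, x ∈ closure (g ⁻¹' {α}) := by
    intro α hα x
    rw [mem_closure_iff]
    intro U hU hxU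
    rcases eq_or_ne α 0 with rfl | h0
    · obtain ⟨y, hyU, hy⟩ := mem_closure_iff.1 (Rat.isDenseEmbedding_coe_real.dense x) U hU hxU
      exact ⟨y, hyU, (hg0 y).2 hy⟩
    · have hc := continuum_le_mk_inter_level hg isClosed_univ hunc hU ⟨x, mem_univ _, hxU⟩ h0 hα
      have hne : (univ ∩ U ∩ g ⁻¹' {α} : Set ℝ).Nonempty := by
        rw [← nonempty_coe_sort, ← mk_ne_zero_iff]
        exact (continuum_pos.trans_le hc).ne'
      obtain ⟨y, ⟨-, hyU⟩, hy⟩ := hne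
      exact ⟨y, hyU, hy⟩
  refine ⟨g, hgμ, fun y α hα ↦ hdense α (hα.trans_lt (hgμ y)) y, ⟨0, fun α hα ↦ hdense α hα 0⟩,
    (countable_range ((↑) : ℚ → ℝ)).mono fun x hx ↦ (hg0 x).1 hx, ?_, mk_real⟩
  intro U hU hxU
  obtain ⟨S, hS, -, hcov⟩ := exists_countable_cover_of_isClosed hg isClosed_univ le_rfl
    (a := fun n ↦ Order.succ (f n)) (fun n ↦ (Order.bot_lt_succ (f n)).ne')
    (fun n ↦ hμ.succ_lt (hfμ n))
    (fun β hβ ↦ (hf β hβ).imp fun n hn ↦ hn.trans (Order.lt_succ _)) hU hxU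
  exact ⟨S, hS, fun y ↦ hcov y (mem_univ y) (hgμ y)⟩

open Classical in
/-- A level can be added on top of a tower: take countably many copies of the tower that converge to
a further copy, of which only a center is kept, as the single point of the new level. A
neighbourhood of this point need not contain any of the copies, but each copy is Lindelöf. -/
theorem IsLindelofTower.exists_add_one {Y : Type} [TopologicalSpace Y]
    {h : Y → Ordinal.{0}} {o : Ordinal.{0}} (H : IsLindelofTower h o) (ho : o ≠ 0) :
    ∃ (c : Y) (h' : {p : ℕ∞ × Y // p.1 = ⊤ → p.2 = c} → Ordinal.{0}),
      IsLindelofTower h' (o + 1) := by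
  obtain ⟨c, hc⟩ := H.exists_center
  let top : {p : ℕ∞ × Y // p.1 = ⊤ → p.2 = c} := ⟨(⊤, c), fun _ ↦ rfl⟩
  let copy : ℕ → Y → {p : ℕ∞ × Y // p.1 = ⊤ → p.2 = c} :=
    fun n y ↦ ⟨(n, y), fun hn ↦ absurd hn (ENat.natCast_ne_top n)⟩
  have hcases : ∀ p, p = top ∨ ∃ n y, p = copy n y := by
    rintro ⟨⟨n, y⟩, hp⟩
    induction n using ENat.recTopCoe with
    | top =>
      left
      have : y = c := hp rfl
      subst this
      rfl
    | coe n => exact Or.inr ⟨n, y, rfl⟩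
  have hcopy : ∀ n, Continuous (copy n) := fun n ↦
    (continuous_const.prodMk continuous_id).subtype_mk _
  let h' : {p : ℕ∞ × Y // p.1 = ⊤ → p.2 = c} → Ordinal.{0} :=
    fun p ↦ if p.1.1 = ⊤ then o else h p.1.2
  have htop : h' top = o := if_pos rfl
  have hcp : ∀ n y, h' (copy n y) = h y := fun n y ↦ if_neg (ENat.natCast_ne_top n)
  have hcopycl : ∀ n y α, y ∈ closure (h ⁻¹' {α}) → copy n y ∈ closure (h' ⁻¹' {α}) := by
    intro n y α hy
    refine closure_mono ?_ (image_closure_subset_closure_image (hcopy n) (mem_image_of_mem _ hy))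
    rintro _ ⟨z, hz, rfl⟩
    exact (hcp n z).trans hz
  have htopcl : ∀ α ≤ o, top ∈ closure (h' ⁻¹' {α}) := by
    intro α hα
    rcases hα.lt_or_eq with hα | rfl
    · have hlim : Filter.Tendsto (fun n ↦ copy n c) Filter.atTop (𝓝 top) := by
        rw [tendsto_subtype_rng]
        exact ENat.tendsto_natCast_nhds_top.prodMk_nhds tendsto_const_nhds
      have := mem_closure_of_tendsto hlim
        (Filter.Eventually.of_forall fun n ↦ hcopycl n c α (hc α hα))
      rwa [closure_closure] at this
    · exact subset_closure htop
  refine ⟨c, h', ?_, ?_, ⟨top, fun α hα ↦ htopcl α (Order.lt_add_one_iff.1 hα)⟩, ?_, ?_, ?_⟩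
  · intro p
    rcases hcases p with rfl | ⟨n, y, rfl⟩
    · rw [htop]; exact lt_add_one o
    · rw [hcp]; exact (H.lt y).trans (lt_add_one o)
  · intro p α hα
    rcases hcases p with rfl | ⟨n, y, rfl⟩
    · exact htopcl α (hα.trans_eq htop)
    · exact hcopycl n y α (H.mem_closure y α (hα.trans_eq (hcp n y)))
  · refine (countable_iUnion fun n ↦ H.countable_zero.image (copy n)).mono ?_
    intro p hp
    rcases hcases p with rfl | ⟨n, y, rfl⟩
    · exact absurd (htop.symm.trans hp) ho
    · exact mem_iUnion.2 ⟨n, y, (hcp n y).symm.trans hp, rfl⟩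
  · intro U hU hpU
    choose S hS hcov using fun n ↦ H.exists_countable_cover (fun y ↦ copy n ⁻¹' U (copy n y))
      (fun y ↦ (hU _).preimage (hcopy n)) (fun y ↦ hpU _)
    refine ⟨insert top (⋃ n, copy n '' S n),
      (countable_iUnion fun n ↦ (hS n).image _).insert _, fun p ↦ ?_⟩
    rcases hcases p with rfl | ⟨n, y, rfl⟩
    · exact Or.inl (mem_insert _ _)
    · rcases hcov n y with hy | ⟨s, hs, hys, hlt⟩
      · exact Or.inl (Or.inr (mem_iUnion.2 ⟨n, mem_image_of_mem _ hy⟩))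
      · exact Or.inr ⟨copy n s, Or.inr (mem_iUnion.2 ⟨n, mem_image_of_mem _ hs⟩), hys,
          by rwa [hcp, hcp]⟩
  · apply le_antisymm
    · calc _ ≤ #(ℕ∞ × Y) := mk_subtype_le _
        _ ≤ ℵ₀ * 𝔠 := by
          rw [mk_prod, Cardinal.lift_id, Cardinal.lift_id, H.card_eq]
          gcongr
          exact mk_le_aleph0
        _ = 𝔠 := by simp
    · rw [← H.card_eq]
      refine mk_le_of_injective (f := copy 0) fun y z hyz ↦ ?_
      exact congrArg (fun p ↦ p.1.2) hyz

/-! ### Towers over families concentrated on a countable set -/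

theorem exists_add_nat_of_lt_add_omega0 {α β : Ordinal.{0}} (h : β < α + ω) :
    ∃ n : ℕ, β < α + (n + 1 : ℕ) := by
  have h1 : β - α < ω := by
    rcases le_or_gt α β with hle | hlt
    · rwa [← add_lt_add_iff_left α, Ordinal.add_sub_cancel_of_le hle]
    · rw [Ordinal.sub_eq_zero_iff_le.2 hlt.le]
      exact omega0_pos
  obtain ⟨n, hn⟩ := lt_omega0.1 h1
  refine ⟨n, ?_⟩
  calc β ≤ α + (β - α) := Ordinal.le_add_sub β α
    _ = α + n := by rw [hn]
    _ < α + (n + 1 : ℕ) := by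
      gcongr
      exact n.lt_succ_self

theorem add_omega0_le_of_lt {α μ : Ordinal.{0}} (hμ : Order.IsSuccLimit μ) (h : α < μ) :
    α + ω ≤ μ := by
  have hn : ∀ n : ℕ, α + n < μ := by
    intro n
    induction n with
    | zero => simpa using h
    | succ n ih =>
      have := hμ.succ_lt ih
      rwa [Order.succ_eq_add_one, add_assoc, ← Nat.cast_succ] at this
  refine le_of_forall_lt fun β hβ ↦ ?_
  obtain ⟨n, hn'⟩ := exists_add_nat_of_lt_add_omega0 hβ
  exact hn'.trans (hn _)

open Classical in
/-- Let `F` be a family of closed, locally uncountable sets that is concentrated on a countable set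
`D`: each open set that contains `D` contains all but countably many members of `F`. If the
uncountable cofinality of `μ` is at most the number of members of `F`, then there is a tower with
a countable top level at height `μ`. Below it there are the initial segments of heights `mₗ` of the
members `F l`, where the `mₗ` are limits of countable cofinality that tend to `μ`; each of these
segments is Lindelöf, and the top level takes care of all but countably many of them. -/
theorem exists_isLindelofTower_of_concentrated {E : Type} [TopologicalSpace E] [PolishSpace E]
    {Λ : Type} {F : Λ → Set E} (hF : ∀ l, IsClosed (F l)) (hFne : ∀ l, (F l).Nonempty)
    (hFu : ∀ l U, IsOpen U → (F l ∩ U).Nonempty → ¬ (F l ∩ U).Countable)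
    {D : Set E} (hD : D.Countable) (hFD : ∀ l, Disjoint (F l) D)
    (hconc : ∀ V, IsOpen V → D ⊆ V → {l | ¬ F l ⊆ V}.Countable)
    {μ : Ordinal.{0}} (hμ : Order.IsSuccLimit μ) (hcof : ℵ₀ < μ.cof) (hμΛ : μ.cof ≤ #Λ)
    (hμc : μ.card ≤ 𝔠) :
    ∃ (Y : Set E) (h : Y → Ordinal.{0}), IsLindelofTower h (μ + 1) := by
  obtain ⟨f, hfμ, hf⟩ := exists_cofinal_map hμ hμΛ
  have hμ1 : 1 < μ := by simpa using hμ.succ_lt hμ.bot_lt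
  -- The points of `D` at which the sets `F l` with `f l > α` accumulate for every `α < μ`.
  let D' : Set E := {d | d ∈ D ∧ ∀ U, IsOpen U → d ∈ U → ∀ α < μ, ∃ l, α < f l ∧
    (F l ∩ U).Nonempty}
  have hD'D : D' ⊆ D := fun _ h ↦ h.1
  have hD'c : D'.Countable := hD.mono hD'D
  have hbad : ∀ d : (D \ D' : Set E), ∃ U, IsOpen U ∧ d.1 ∈ U ∧ ∃ α < μ, ∀ l, α < f l →
      ¬ (F l ∩ U).Nonempty := by
    rintro ⟨d, hd, hd'⟩
    by_contra! hcon
    exact hd' ⟨hd, hcon⟩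
  choose B hBo hdB α hαμ hα using hbad
  have : Countable (D \ D' : Set E) := (hD.mono sdiff_subset).to_subtype
  -- Above `αs` no set `F l` meets the neighbourhoods of the remaining points of `D`.
  let αs : Ordinal.{0} := ⨆ d, α d
  have hαs : αs < μ := iSup_lt_of_lt_cof (mk_le_aleph0.trans_lt hcof) hαμ
  have hαle : ∀ d, α d ≤ αs := fun d ↦ Ordinal.le_iSup α d
  have hconc' : ∀ V, IsOpen V → D' ⊆ V → {l | αs < f l ∧ ¬ F l ⊆ V}.Countable := by
    intro V hV hDV
    refine (hconc (V ∪ ⋃ d, B d) (hV.union (isOpen_iUnion hBo)) ?_).mono ?_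
    · intro d hd
      by_cases hd' : d ∈ D'
      · exact Or.inl (hDV hd')
      · exact Or.inr (mem_iUnion.2 ⟨⟨d, hd, hd'⟩, hdB _⟩)
    · rintro l ⟨hl, hlV⟩ hsub
      refine hlV fun x hx ↦ (hsub hx).resolve_right fun hxB ↦ ?_
      obtain ⟨d, hd⟩ := mem_iUnion.1 hxB
      exact hα d l ((hαle d).trans_lt hl) ⟨x, hx, hd⟩
  have hacc : ∀ d ∈ D', ∀ U, IsOpen U → d ∈ U → ∀ β < μ, ∃ l, αs < f l ∧ β < f l ∧
      (F l ∩ U).Nonempty := by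
    intro d hd U hU hdU β hβ
    obtain ⟨l, hl, hne⟩ := hd.2 U hU hdU (max αs β) (max_lt hαs hβ)
    exact ⟨l, (le_max_left _ _).trans_lt hl, (le_max_right _ _).trans_lt hl, hne⟩
  have hD'ne : D'.Nonempty := by
    by_contra hemp
    rw [not_nonempty_iff_eq_empty] at hemp
    have hc : {l | αs < f l}.Countable := by
      refine (hconc' ∅ isOpen_empty hemp.subset).mono ?_
      intro l hl
      obtain ⟨x, hx⟩ := hFne l
      exact ⟨hl, fun hsub ↦ hsub hx⟩
    have := hc.to_subtype
    have hsup : (⨆ l : {l | αs < f l}, f l.1) < μ :=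
      iSup_lt_of_lt_cof (mk_le_aleph0.trans_lt hcof) fun l ↦ hfμ l.1
    obtain ⟨l, hl⟩ := hf _ (max_lt hαs hsup)
    have h1 : αs < f l := (le_max_left _ _).trans_lt hl
    have h2 := Ordinal.le_iSup (fun l : {l | αs < f l} ↦ f l.1) ⟨l, h1⟩
    exact ((le_max_right _ _).trans_lt hl).not_ge h2
  let Z : Set E := ⋃ l ∈ {l | αs < f l}, F l
  obtain ⟨Q, hQc, hQZ, hQd⟩ : ∃ Q : Set E, Q.Countable ∧ Q ⊆ Z ∧
      ∀ x ∈ Z, ∀ U, IsOpen U → x ∈ U → (Q ∩ U).Nonempty := by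
    obtain ⟨s, hs, hsd⟩ := TopologicalSpace.exists_countable_dense Z
    refine ⟨Subtype.val '' s, hs.image _, Subtype.coe_image_subset Z s, fun x hx U hU hxU ↦ ?_⟩
    obtain ⟨q, hqU, hq⟩ := hsd.inter_open_nonempty _ (hU.preimage continuous_subtype_val)
      ⟨⟨x, hx⟩, hxU⟩
    exact ⟨q.1, mem_image_of_mem _ hq, hqU⟩
  obtain ⟨g, hg0, hgμ, hg⟩ := exists_bernstein_levels hQc hμ1 hμc
  have hm : ∀ l, f l + ω ≤ μ := fun l ↦ add_omega0_le_of_lt hμ (hfμ l)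
  let Y : Set E := D' ∪ {x | ∃ l, αs < f l ∧ x ∈ F l ∧ g x < f l + ω}
  have hFD' : ∀ l, ∀ x ∈ F l, x ∉ D' := fun l x hx hxD ↦
    disjoint_left.1 (hFD l) hx (hD'D hxD)
  let h : Y → Ordinal.{0} := fun y ↦ if y.1 ∈ D' then μ else g y.1
  have hhD : ∀ y : Y, y.1 ∈ D' → h y = μ := fun y hy ↦ if_pos hy
  have hhg : ∀ y : Y, y.1 ∉ D' → h y = g y.1 := fun y hy ↦ if_neg hy
  have hkey : ∀ l, αs < f l → ∀ U, IsOpen U → (F l ∩ U).Nonempty → ∀ β < f l + ω,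
      ∃ y : Y, y.1 ∈ U ∧ h y = β := by
    intro l hl U hU hne β hβ
    rcases eq_or_ne β 0 with rfl | hβ0
    · obtain ⟨x, hxF, hxU⟩ := hne
      obtain ⟨q, hqQ, hqU⟩ := hQd x (mem_biUnion (x := l) hl hxF) U hU hxU
      obtain ⟨l', hl', hql'⟩ := mem_iUnion₂.1 (hQZ hqQ)
      have hgq : g q = 0 := (hg0 q).2 hqQ
      have hqD : q ∉ D' := hFD' l' q hql'
      exact ⟨⟨q, Or.inr ⟨l', hl', hql', by rw [hgq]; exact omega0_pos.trans_le le_add_self⟩⟩, hqU,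
        (hhg _ hqD).trans hgq⟩
    · have hc := continuum_le_mk_inter_level hg (hF l) (hFu l) hU hne hβ0 (hβ.trans_le (hm l))
      have hne' : (F l ∩ U ∩ g ⁻¹' {β} : Set E).Nonempty := by
        rw [← nonempty_coe_sort, ← mk_ne_zero_iff]
        exact (continuum_pos.trans_le hc).ne'
      obtain ⟨x, ⟨hxF, hxU⟩, hxβ⟩ := hne'
      have hxβ' : g x = β := hxβ
      exact ⟨⟨x, Or.inr ⟨l, hl, hxF, hxβ'.trans_lt hβ⟩⟩, hxU, (hhg _ (hFD' l x hxF)).trans hxβ'⟩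
  have hclD : ∀ y : Y, y.1 ∈ D' → ∀ β ≤ μ, y ∈ closure (h ⁻¹' {β}) := by
    intro y hy β hβ
    rcases hβ.lt_or_eq with hβ | rfl
    · rw [mem_closure_iff]
      rintro _ ⟨U, hU, rfl⟩ hyU
      obtain ⟨l, hl, hβl, hne⟩ := hacc y.1 hy U hU hyU β hβ
      obtain ⟨z, hzU, hz⟩ := hkey l hl U hU hne β (hβl.trans_le le_self_add)
      exact ⟨z, hzU, hz⟩
    · exact subset_closure (hhD y hy)
  refine ⟨Y, h, ?_, ?_, ?_, ?_, ?_, ?_⟩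
  · intro y
    by_cases hy : y.1 ∈ D'
    · rw [hhD y hy]; exact lt_add_one μ
    · rw [hhg y hy]; exact (hgμ _).trans (lt_add_one μ)
  · intro y β hβ
    by_cases hy : y.1 ∈ D'
    · exact hclD y hy β (hβ.trans_eq (hhD y hy))
    · obtain ⟨l, hl, hyF, hyl⟩ := y.2.resolve_left hy
      rw [hhg y hy] at hβ
      rw [mem_closure_iff]
      rintro _ ⟨U, hU, rfl⟩ hyU
      obtain ⟨z, hzU, hz⟩ := hkey l hl U hU ⟨y.1, hyF, hyU⟩ β (hβ.trans_lt hyl)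
      exact ⟨z, hzU, hz⟩
  · obtain ⟨d, hd⟩ := hD'ne
    exact ⟨⟨d, Or.inl hd⟩, fun β hβ ↦ hclD _ hd β (Order.lt_add_one_iff.1 hβ)⟩
  · refine (hQc.preimage Subtype.val_injective).mono fun y hy ↦ ?_
    have hy0 : h y = 0 := hy
    by_cases hyD : y.1 ∈ D'
    · exact absurd ((hhD y hyD).symm.trans hy0) (zero_lt_one.trans hμ1).ne'
    · exact (hg0 y.1).1 ((hhg y hyD).symm.trans hy0)
  · intro U hU hyU
    have hW : ∀ y : Y, ∃ W : Set E, IsOpen W ∧ Subtype.val ⁻¹' W = U y := fun y ↦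
      isOpen_induced_iff.1 (hU y)
    choose W hWo hWU using hW
    let G : E → Set E := fun x ↦ if hx : x ∈ Y then W ⟨x, hx⟩ else Set.univ
    have hGY : ∀ y : Y, G y.1 = W y := fun y ↦ dif_pos y.2
    have hGo : ∀ x, IsOpen (G x) := by
      intro x
      by_cases hx : x ∈ Y
      · rw [hGY ⟨x, hx⟩]; exact hWo _
      · simp [G, hx]
    have hxG : ∀ x, x ∈ G x := by
      intro x
      by_cases hx : x ∈ Y
      · rw [hGY ⟨x, hx⟩]
        have := hyU ⟨x, hx⟩
        rw [← hWU] at this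
        exact this
      · simp [G, hx]
    have hGU : ∀ y s : Y, y.1 ∈ G s.1 → y ∈ U s := by
      intro y s hys
      rw [hGY] at hys
      rw [← hWU]
      exact hys
    let V : Set E := ⋃ d ∈ D', G d
    have hVo : IsOpen V := isOpen_biUnion fun d _ ↦ hGo d
    have hDV : D' ⊆ V := fun d hd ↦ mem_biUnion hd (hxG d)
    have hBc := hconc' V hVo hDV
    choose S hSc hSF hS using fun l ↦ exists_countable_cover_of_isClosed hg (hF l) (hm l)
      (a := fun n : ℕ ↦ f l + (n + 1 : ℕ))
      (fun n ↦ ((Order.bot_lt_succ (n : Ordinal)).trans_le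
        (by rw [Order.succ_eq_add_one, ← Nat.cast_succ]; exact le_add_self)).ne')
      (fun n ↦ (add_lt_add_iff_left _).2 (natCast_lt_omega0 _))
      (fun β hβ ↦ exists_add_nat_of_lt_add_omega0 hβ) hGo hxG
    let T : Set E := D' ∪ ⋃ l ∈ {l | αs < f l ∧ ¬ F l ⊆ V}, S l
    have hTc : T.Countable := hD'c.union (hBc.biUnion fun l _ ↦ hSc l)
    refine ⟨Subtype.val ⁻¹' T, hTc.preimage Subtype.val_injective, fun y ↦ ?_⟩
    by_cases hyD : y.1 ∈ D'
    · exact Or.inl (Or.inl hyD)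
    by_cases hyV : y.1 ∈ V
    · obtain ⟨d, hd, hyd⟩ := mem_iUnion₂.1 hyV
      refine Or.inr ⟨⟨d, Or.inl hd⟩, Or.inl hd, hGU _ _ hyd, ?_⟩
      rw [hhg y hyD, hhD _ hd]
      exact hgμ _
    · obtain ⟨l, hl, hyF, hyl⟩ := y.2.resolve_left hyD
      have hlB : l ∈ {l | αs < f l ∧ ¬ F l ⊆ V} := ⟨hl, fun hsub ↦ hyV (hsub hyF)⟩
      rcases hS l y.1 hyF hyl with hyS | ⟨s, hs, hys, hlt⟩
      · exact Or.inl (Or.inr (mem_biUnion hlB hyS))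
      · have hsF := hSF l hs
        refine Or.inr ⟨⟨s, Or.inr ⟨l, hl, hsF⟩⟩, Or.inr (mem_biUnion hlB hs), hGU _ _ hys, ?_⟩
        rw [hhg y hyD, hhg _ (hFD' l s hsF.1)]
        exact hlt
  · apply le_antisymm ((mk_subtype_le _).trans (mk_le_continuum_of_secondCountable E))
    obtain ⟨l, hl⟩ := hf _ hαs
    have hc := continuum_le_mk_inter_level hg (hF l) (hFu l) isOpen_univ
      (by rw [inter_univ]; exact hFne l) one_ne_zero hμ1
    refine hc.trans (mk_le_mk_of_subset fun x hx ↦ Or.inr ⟨l, hl, hx.1.1, ?_⟩)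
    have hx1 : g x = 1 := hx.2
    rw [hx1]
    exact one_lt_omega0.trans_le le_add_self

/-! ### A concentrated family from a `𝒦`-Lusin set -/

theorem not_countable_of_isOpen_nat_bool {O : Set (ℕ → Bool)} (hO : IsOpen O)
    (hne : O.Nonempty) : ¬ O.Countable := by
  classical
  obtain ⟨e, he⟩ := hne
  obtain ⟨I, u, hu, hsub⟩ := isOpen_pi_iff.1 hO e he
  let n := I.sup id + 1
  -- The sequences that agree with `e` below `n` are parametrized by their tails.
  let φ : (ℕ → Bool) → ℕ → Bool := fun t i ↦ if i < n then e i else t (i - n)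
  have hφO : ∀ t, φ t ∈ O := by
    refine fun t ↦ hsub fun i hi ↦ ?_
    have : i < n := Nat.lt_succ_of_le (Finset.le_sup (f := id) hi)
    simp only [φ, this, if_true]
    exact (hu i hi).2
  have hφ : Function.Injective φ := by
    intro s t hst
    funext i
    simpa [φ] using congrFun hst (i + n)
  intro hc
  have h1 : #(ℕ → Bool) ≤ #O :=
    mk_le_of_injective (f := fun t ↦ (⟨φ t, hφO t⟩ : O)) fun _ _ h ↦ hφ (congrArg Subtype.val h)
  have h2 : #(ℕ → Bool) = 𝔠 := by simp
  exact (h2 ▸ h1).not_gt (hc.le_aleph0.trans_lt aleph0_lt_continuum)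

/-- The compact space of monotone sequences in `ℕ∞`: a compactification of the space of monotone
sequences of natural numbers, which is a copy of the Baire space, with countable remainder. -/
abbrev MonotoneSeq : Type := {x : ℕ → ℕ∞ // Monotone x}

namespace MonotoneSeq

theorem isClosed_setOf_monotone : IsClosed {x : ℕ → ℕ∞ | Monotone x} := by
  have : {x : ℕ → ℕ∞ | Monotone x} = ⋂ (i) (j) (_ : i ≤ j), {x : ℕ → ℕ∞ | x i ≤ x j} := by
    ext x
    simp [Monotone]
  rw [this]
  exact isClosed_iInter fun i ↦ isClosed_iInter fun j ↦ isClosed_iInter fun _ ↦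
    isClosed_le (continuous_apply i) (continuous_apply j)

instance : CompactSpace MonotoneSeq := isCompact_iff_compactSpace.1 isClosed_setOf_monotone.isCompact

instance : PolishSpace MonotoneSeq := by
  have : TopologicalSpace.MetrizableSpace MonotoneSeq := IsEmbedding.subtypeVal.metrizableSpace
  let := TopologicalSpace.metrizableSpaceMetric MonotoneSeq
  infer_instance

/-- The remainder: the monotone sequences that attain the value `⊤`. -/
def remainder : Set MonotoneSeq := {x | ∃ n, x.1 n = ⊤}

theorem countable_remainder : remainder.Countable := by
  have : remainder = ⋃ n, {x : MonotoneSeq | x.1 n = ⊤} := by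
    ext x
    simp [remainder]
  rw [this]
  refine countable_iUnion fun n ↦ ?_
  let r : MonotoneSeq → Fin n → ℕ∞ := fun x i ↦ x.1 i
  refine MapsTo.countable_of_injOn (f := r) (t := univ) (mapsTo_univ _ _) ?_ countable_univ
  intro x hx y hy hxy
  ext1
  funext i
  rcases lt_or_ge i n with hi | hi
  · exact congrFun hxy ⟨i, hi⟩
  · have hx' : x.1 n = ⊤ := hx
    have hy' : y.1 n = ⊤ := hy
    rw [top_le_iff.1 (hx'.symm.trans_le (x.2 hi)), top_le_iff.1 (hy'.symm.trans_le (y.2 hi))]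

theorem exists_forall_le_of_isCompact {K : Set MonotoneSeq} (hK : IsCompact K)
    (hKr : Disjoint K remainder) : ∃ M : ℕ → ℕ, ∀ x ∈ K, ∀ n, x.1 n ≤ M n := by
  have hn : ∀ n, ∃ m : ℕ, ∀ x ∈ K, x.1 n ≤ m := by
    intro n
    rcases K.eq_empty_or_nonempty with rfl | hne
    · exact ⟨0, fun x hx ↦ absurd hx (notMem_empty x)⟩
    · obtain ⟨z, hzK, hz⟩ := hK.exists_isMaxOn hne
        ((continuous_apply n).comp continuous_subtype_val).continuousOn
      have hzt : z.1 n ≠ ⊤ := fun h ↦ disjoint_left.1 hKr hzK ⟨n, h⟩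
      obtain ⟨m, hm⟩ := ENat.ne_top_iff_exists.1 hzt
      exact ⟨m, fun x hx ↦ (hz hx).trans_eq hm.symm⟩
  choose M hM using hn
  exact ⟨M, fun x hx n ↦ hM n x hx⟩

/-- The sequence of the partial sums of `l + e`. -/
def sumSeq (l : ℕ → ℕ) (e : ℕ → Bool) : MonotoneSeq :=
  ⟨fun n ↦ ((∑ i ∈ Finset.range n, (l i + (e i).toNat) : ℕ) : ℕ∞), fun _ _ h ↦
    Nat.cast_le.2 (Finset.sum_le_sum_of_subset (Finset.range_mono h))⟩

theorem continuous_sumSeq (l : ℕ → ℕ) : Continuous (sumSeq l) := by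
  refine Continuous.subtype_mk (continuous_pi fun n ↦ ?_) _
  refine ENat.isEmbedding_natCast.continuous.comp ?_
  exact continuous_finsetSum _ fun i _ ↦ continuous_const.add
    ((continuous_of_discreteTopology (f := Bool.toNat)).comp (continuous_apply i))

theorem sumSeq_injective (l : ℕ → ℕ) : Function.Injective (sumSeq l) := by
  intro e e' h
  have hn : ∀ n, ∑ i ∈ Finset.range n, (l i + (e i).toNat) =
      ∑ i ∈ Finset.range n, (l i + (e' i).toNat) := fun n ↦
    Nat.cast_injective (R := ℕ∞) (congrFun (congrArg Subtype.val h) n)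
  funext n
  have h1 := hn (n + 1)
  rw [Finset.sum_range_succ, Finset.sum_range_succ, hn n] at h1
  have h2 : (e n).toNat = (e' n).toNat := by omega
  cases h3 : e n <;> cases h4 : e' n <;> simp_all

theorem not_countable_range_sumSeq_inter (l : ℕ → ℕ) {U : Set MonotoneSeq} (hU : IsOpen U)
    (hne : (range (sumSeq l) ∩ U).Nonempty) : ¬ (range (sumSeq l) ∩ U).Countable := by
  obtain ⟨_, ⟨e, rfl⟩, heU⟩ := hne
  intro hc
  refine not_countable_of_isOpen_nat_bool (hU.preimage (continuous_sumSeq l)) ⟨e, heU⟩ ?_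
  refine (hc.preimage (sumSeq_injective l)).mono ?_
  exact fun t ht ↦ ⟨mem_range_self t, ht⟩

theorem disjoint_range_sumSeq_remainder (l : ℕ → ℕ) :
    Disjoint (range (sumSeq l)) remainder := by
  rw [disjoint_left]
  rintro _ ⟨e, rfl⟩ ⟨n, hn⟩
  exact ENat.natCast_ne_top _ hn

/-- If `L` is `𝒦`-Lusin, then the family of the sets `range (sumSeq l)` for `l ∈ L` is concentrated
on the remainder: the members that meet a compact set disjoint from the remainder come from
sequences `l` below a fixed bound. -/
theorem countable_not_range_sumSeq_subset {L : Set (ℕ → ℕ)} (hL : IsKLusin L)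
    {V : Set MonotoneSeq} (hV : IsOpen V) (hrV : remainder ⊆ V) :
    {l : L | ¬ range (sumSeq l.1) ⊆ V}.Countable := by
  obtain ⟨M, hM⟩ := exists_forall_le_of_isCompact hV.isClosed_compl.isCompact
    (disjoint_compl_left_iff_subset.2 hrV)
  have hK : IsCompact (Set.univ.pi fun n ↦ Iic (M (n + 1))) :=
    isCompact_univ_pi fun n ↦ (finite_Iic _).isCompact
  refine ((hL _ hK).preimage Subtype.val_injective).mono ?_
  intro l hl
  obtain ⟨_, ⟨e, rfl⟩, he⟩ := not_subset.1 hl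
  refine ⟨fun n _ ↦ ?_, l.2⟩
  have h1 : ∑ i ∈ Finset.range (n + 1), (l.1 i + (e i).toNat) ≤ M (n + 1) :=
    Nat.cast_le.1 (hM _ he (n + 1))
  rw [Finset.sum_range_succ] at h1
  have h2 : l.1 n ≤ M (n + 1) := by omega
  exact h2

end MonotoneSeq

/-! ### Separable special FLS spaces of prescribed height -/

theorem exists_isLindelofTower_add_nat {Y : Type} [TopologicalSpace Y]
    [TopologicalSpace.MetrizableSpace Y] {h : Y → Ordinal.{0}} {o : Ordinal.{0}}
    (H : IsLindelofTower h o) (ho : o ≠ 0) (n : ℕ) :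
    ∃ (Y' : Type) (_ : TopologicalSpace Y') (_ : TopologicalSpace.MetrizableSpace Y')
      (h' : Y' → Ordinal.{0}), IsLindelofTower h' (o + n) := by
  induction n with
  | zero => exact ⟨Y, _, inferInstance, h, by simpa using H⟩
  | succ n ih =>
    obtain ⟨Y', _, _, h', H'⟩ := ih
    obtain ⟨c, h'', H''⟩ := H'.exists_add_one
      ((pos_iff_ne_zero.2 ho).trans_le le_self_add).ne'
    refine ⟨_, _, IsEmbedding.subtypeVal.metrizableSpace, h'', ?_⟩
    rwa [Nat.cast_succ, ← add_assoc]

theorem theorem4p3 (κ : Cardinal.{0}) (hκ : ℵ₀ < κ)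
    (hL : ∃ L : Set (ℕ → ℕ), IsKLusin L ∧ #L = κ)
    (l : Ordinal.{0}) (hl : ω ≤ l) (hlc : l < (Order.succ 𝔠).ord)
    (hcof : l.cof ≤ ℵ₀) (hlim : (limitPart l).cof ≤ κ) :
    ∃ (X : Type) (_ : TopologicalSpace X),
      IsFLS X ∧ IsSpecial X ∧ TopologicalSpace.SeparableSpace X ∧ #X = 𝔠 ∧
        HasScatteredHeight X l := by
  obtain ⟨L, hL, rfl⟩ := hL
  obtain ⟨hμ, n, hn⟩ := (limitPart_eq_iff l _).1 rfl
  generalize limitPart l = μ at hμ hn hlim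
  subst hn
  have hμ0 : μ ≠ 0 := by
    rintro rfl
    rw [zero_add] at hl
    exact (natCast_lt_omega0 n).not_ge hl
  have hμl : Order.IsSuccLimit μ := ⟨by rwa [isMin_iff_eq_bot], hμ⟩
  have hμc : μ.card ≤ 𝔠 :=
    Order.lt_succ_iff.1 (lt_ord.1 (lt_of_le_of_lt le_self_add hlc))
  rcases le_or_gt μ.cof ℵ₀ with hc | hc
  · obtain ⟨h, H⟩ := exists_isLindelofTower_of_cof_le hμl hc hμc
    obtain ⟨Y, _, _, h', H'⟩ := exists_isLindelofTower_add_nat H hμ0 n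
    exact H'.exists_space
  · cases n with
    | zero => exact absurd hcof (by simpa using hc)
    | succ n =>
      obtain ⟨Y, h, H⟩ := exists_isLindelofTower_of_concentrated
        (F := fun l : L ↦ range (MonotoneSeq.sumSeq l.1))
        (fun l ↦ (isCompact_range (MonotoneSeq.continuous_sumSeq l.1)).isClosed)
        (fun l ↦ range_nonempty _) (fun l _ ↦ MonotoneSeq.not_countable_range_sumSeq_inter l.1)
        MonotoneSeq.countable_remainder
        (fun l ↦ MonotoneSeq.disjoint_range_sumSeq_remainder l.1)
        (fun _ ↦ MonotoneSeq.countable_not_range_sumSeq_subset hL) hμl hc hlim hμc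
      obtain ⟨Y', _, _, h', H'⟩ := exists_isLindelofTower_add_nat H
        ((pos_iff_ne_zero.2 hμ0).trans_le le_self_add).ne' n
      rw [add_assoc, ← Nat.cast_one, ← Nat.cast_add, add_comm 1 n] at H'
      exact H'.exists_space
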